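/- Let $N$ be a lattice (a free abelian group of finite rank), $M=\operatorname{Hom}(N,\mathbb{Z})$, $N_{\mathbb{R}}=N\otimes_{\mathbb{Z}}\mathbb{R}$, and let $\Gamma$ be an additive subgroup of $\mathbb{R}$. A fan in a real vector space is a finite nonempty set of strongly convex polyhedral cones (cones containing no line, each cut out by finitely many homogeneous linear inequalities) which contains all faces of its members and in which the intersection of any two members is a face of both. A fan in $N_{\mathbb{R}}\times\mathbb{R}_{\geq 0}$ is a fan in $N_{\mathbb{R}}\times\mathbb{R}$ all of whose cones lie in the half-space $N_{\mathbb{R}}\times\mathbb{R}_{\geq 0}$. It is $\Gamma$-admissible if each of its cones has the form $\{(w,t)\in N_{\mathbb{R}}\times\mathbb{R}_{\geq 0} : \langle u_i,w\rangle+\gamma_i t\geq 0,\ i=1,\dots,\ell\}$ with $u_i\in M$ and $\gamma_i\in\Gamma$. A fan in $N_{\mathbb{R}}\times\mathbb{R}^k$ is rational if each of its cones has the form $\{(w,\xi) : \langle u_i,w\rangle+f_i\cdot\xi\geq 0,\ i=1,\dots,\ell\}$ with $u_i\in M$ and $f_i\in\mathbb{Z}^k$. A linear map $\iota\colon\mathbb{R}_{\geq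 0}\to\mathbb{R}^k$ is the restriction of a linear map $\mathbb{R}\to\mathbb{R}^k$. If $\iota(1)\neq 0$, put $\varphi=\operatorname{id}_{N_{\mathbb{R}}}\times\iota\colon N_{\mathbb{R}}\times\mathbb{R}_{\geq 0}\to N_{\mathbb{R}}\times\mathbb{R}^k$; the pullback of a fan $\widetilde\Sigma$ in $N_{\mathbb{R}}\times\mathbb{R}^k$ along $\varphi$ is $$\varphi^*(\widetilde\Sigma)=\{\varphi^{-1}(\sigma),\ \varphi^{-1}(\sigma)\cap(N_{\mathbb{R}}\times\{0\}) : \sigma\in\widetilde\Sigma\}.$$ **Theorem 1.3 (Combinatorial noetherian reduction).** 1. For every $\Gamma$-admissible fan $\Sigma$ in $N_{\mathbb{R}}\times\mathbb{R}_{\geq 0}$ there are a positive integer $k$, a linear map $\iota\colon\mathbb{R}_{\geq 0}\to\mathbb{R}^k$ sending $1$ to a nonzero point of $\Gamma^k$, and a rational fan $\widetilde\Sigma$ in $N_{\mathbb{R}}\times\mathbb{R}^k$ such that $\Sigma=(\operatorname{id}_{N_{\mathbb{R}}}\times\iota)^*(\widetilde\Sigma)$. 2. Suppose that $\Gamma\neq\{0\}$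 and that $\Gamma$ is finitely generated or, more generally, that the $\mathbb{Q}$-subspace $\mathbb{Q}\Gamma\subset\mathbb{R}$ spanned by $\Gamma$ is finite-dimensional over $\mathbb{Q}$. Then $k$ and $\iota$ can be chosen independently of $\Sigma$: there are a positive integer $k$ and a linear map $\iota\colon\mathbb{R}_{\geq 0}\to\mathbb{R}^k$ sending $1$ to a nonzero point of $\Gamma^k$ such that every $\Gamma$-admissible fan $\Sigma$ in $N_{\mathbb{R}}\times\mathbb{R}_{\geq 0}$ equals $(\operatorname{id}_{N_{\mathbb{R}}}\times\iota)^*(\widetilde\Sigma)$ for some rational fan $\widetilde\Sigma$ in $N_{\mathbb{R}}\times\mathbb{R}^k$. -/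

import Mathlib

open scoped TensorProduct

/-! ### Cones and fans in a real vector space -/

section Fans

variable {V W : Type*} [AddCommGroup V] [Module ℝ V] [AddCommGroup W] [Module ℝ W]

/-- A cone is polyhedral if it is `L^∨` for a finite set `L` of linear functionals. -/
def IsPolyhedralCone (σ : PointedCone ℝ V) : Prop :=
  ∃ L : Finset (Module.Dual ℝ V), ∀ x : V, x ∈ σ ↔ ∀ u ∈ L, 0 ≤ u x

/-- A cone is strongly convex if it contains no line. -/
def IsStronglyConvex (σ : PointedCone ℝ V) : Prop := σ.toConvexCone.Salient

/-- `τ` is a face of the cone `σ`: there is a linear functional `u` which is nonnegative on `σ`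
and `τ = σ ∩ u^⊥`. The functional `u = 0` is allowed, so `σ` is a face of itself. -/
def IsConeFace (τ σ : PointedCone ℝ V) : Prop :=
  ∃ u : Module.Dual ℝ V, (∀ x ∈ σ, 0 ≤ u x) ∧ ∀ x : V, x ∈ τ ↔ x ∈ σ ∧ u x = 0

/-- A fan in `V`: a finite nonempty collection of strongly convex polyhedral cones, closed under
taking faces, such that any two of its cones intersect in a common face. -/
structure IsFan (F : Set (PointedCone ℝ V)) : Prop where
  finite : F.Finite
  nonempty : F.Nonempty
  polyhedral : ∀ σ ∈ F, IsPolyhedralCone σ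
  stronglyConvex : ∀ σ ∈ F, IsStronglyConvex σ
  face_mem : ∀ σ ∈ F, ∀ τ : PointedCone ℝ V, IsConeFace τ σ → τ ∈ F
  inter_face : ∀ σ ∈ F, ∀ τ ∈ F, IsConeFace (σ ⊓ τ) σ ∧ IsConeFace (σ ⊓ τ) τ

variable (V) in
/-- The half-space `V × ℝ_{≥0}` in `V × ℝ`, as a cone. -/
def upperHalfSpace : PointedCone ℝ (V × ℝ) :=
  (PointedCone.positive ℝ ℝ).comap (LinearMap.snd ℝ V ℝ)

variable (V) in
/-- The boundary hyperplane `V × {0}` in `V × ℝ`, as a cone. -/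
def heightZero : PointedCone ℝ (V × ℝ) :=
  PointedCone.comap (LinearMap.snd ℝ V ℝ) ⊥

theorem mem_upperHalfSpace {x : V × ℝ} : x ∈ upperHalfSpace V ↔ 0 ≤ x.2 := by
  simp [upperHalfSpace]

theorem mem_heightZero {x : V × ℝ} : x ∈ heightZero V ↔ x.2 = 0 := by
  simp [heightZero]

/-- The pullback `φ^*(F)` of a collection `F` of cones in `W` along (the restriction to the
half-space `V × ℝ_{≥0}` of) a linear map `φ : V × ℝ → W`. It consists of the preimages of the
cones of `F` in `V × ℝ_{≥0}` and of their preimages in `V × {0}`. -/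
def fanPullback (φ : V × ℝ →ₗ[ℝ] W) (F : Set (PointedCone ℝ W)) :
    Set (PointedCone ℝ (V × ℝ)) :=
  {τ | ∃ σ ∈ F, τ = σ.comap φ ⊓ upperHalfSpace V ∨ τ = σ.comap φ ⊓ heightZero V}

end Fans

/-! ### Rational and admissible fans over a lattice `N`

The dual lattice is `M = Hom(N, ℤ) = Module.Dual ℤ N`, and `N_ℝ = ℝ ⊗[ℤ] N`. -/

section Lattice

variable {N : Type*} [AddCommGroup N]

/-- The pairing `⟨u, w⟩` of `u ∈ M` with `w ∈ N_ℝ`: the `ℝ`-linear extension of `u` to `N_ℝ`. -/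
noncomputable def latticePairing (u : Module.Dual ℤ N) : Module.Dual ℝ (ℝ ⊗[ℤ] N) :=
  Module.Dual.baseChange ℝ u

theorem latticePairing_tmul (u : Module.Dual ℤ N) (r : ℝ) (n : N) :
    latticePairing u (r ⊗ₜ[ℤ] n) = (u n : ℝ) * r := by
  simp [latticePairing]

/-- A cone in `N_ℝ × ℝ^k` is rational if it is `L^∨` for a finite set `L ⊂ M × ℤ^k`, with the
pairing `⟨(u, f), (w, ξ)⟩ = ⟨u, w⟩ + f · ξ`. -/
def IsRationalCone {k : ℕ} (σ : PointedCone ℝ ((ℝ ⊗[ℤ] N) × (Fin k → ℝ))) : Prop :=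
  ∃ L : Finset (Module.Dual ℤ N × (Fin k → ℤ)), ∀ x : (ℝ ⊗[ℤ] N) × (Fin k → ℝ),
    x ∈ σ ↔ ∀ y ∈ L, 0 ≤ latticePairing y.1 x.1 + ∑ i, (y.2 i : ℝ) * x.2 i

/-- A rational fan in `N_ℝ × ℝ^k`. -/
structure IsRationalFan {k : ℕ} (F : Set (PointedCone ℝ ((ℝ ⊗[ℤ] N) × (Fin k → ℝ)))) : Prop where
  isFan : IsFan F
  rational : ∀ σ ∈ F, IsRationalCone σ

/-- A cone in `N_ℝ × ℝ_{≥0}` is `Γ`-admissible if it is strongly convex and is `L^∨` for a finite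
set `L ⊂ M × Γ`, with the pairing `⟨(u, γ), (w, t)⟩ = ⟨u, w⟩ + γ t` on `N_ℝ × ℝ_{≥0}`. -/
def IsAdmissibleCone (Γ : AddSubgroup ℝ) (σ : PointedCone ℝ ((ℝ ⊗[ℤ] N) × ℝ)) : Prop :=
  IsStronglyConvex σ ∧
    ∃ L : Finset (Module.Dual ℤ N × Γ), ∀ x : (ℝ ⊗[ℤ] N) × ℝ,
      x ∈ σ ↔ 0 ≤ x.2 ∧ ∀ y ∈ L, 0 ≤ latticePairing y.1 x.1 + (y.2 : ℝ) * x.2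

/-- A `Γ`-admissible fan in `N_ℝ × ℝ_{≥0}`: a fan in `N_ℝ × ℝ` which is supported in the
half-space `N_ℝ × ℝ_{≥0}` and consists of `Γ`-admissible cones. -/
structure IsAdmissibleFan (Γ : AddSubgroup ℝ) (F : Set (PointedCone ℝ ((ℝ ⊗[ℤ] N) × ℝ))) :
    Prop where
  isFan : IsFan F
  supported : ∀ σ ∈ F, ∀ x ∈ σ, 0 ≤ x.2
  admissible : ∀ σ ∈ F, IsAdmissibleCone Γ σ

/-- The map `id × ι : N_ℝ × ℝ → N_ℝ × ℝ^k`. -/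
noncomputable def idProd (N : Type*) [AddCommGroup N] {k : ℕ} (ι : ℝ →ₗ[ℝ] (Fin k → ℝ)) :
    (ℝ ⊗[ℤ] N) × ℝ →ₗ[ℝ] (ℝ ⊗[ℤ] N) × (Fin k → ℝ) :=
  LinearMap.prodMap LinearMap.id ι

end Lattice

/-! A fan has finitely many cones, so only finitely many elements of `Γ` occur in it and the first
claim reduces to the second for a finitely generated subgroup (`IsAdmissibleFan.exists_fg`). For `Γ`
of finite rank, let `ι 1 = e` be a `ℚ`-basis of `ℚΓ` taken from `Γ`. After clearing denominators,
each inequality defining an admissible cone is the restriction to the ray `ℝ_{≥0} e` of a rational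
inequality on `N_ℝ × ℝ^k`.

The cones lifted this way need not form a fan, since they are controlled only over the ray. But `e`
lies on no rational hyperplane, so an implication between rational inequalities that holds over the
ray holds over a rational half-space with `e` in its interior (`exists_halfspace_of_nonneg`, by
Fourier–Motzkin elimination over `ℤ`). That two cones meet in a common face amounts to finitely many
such implications. Hence, over a small enough rational cone around `e`, the lifts meet in common
faces (`exists_finset_isConeFace_inf`). Their faces form the rational fan, which pulls back to the
given one. -/

/-! ### Fourier–Motzkin elimination and Farkas' lemma -/

section FourierMotzkin

variable {R : Type} [CommRing R] [LinearOrder R] [IsStrictOrderedRing R]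

/-- Fourier–Motzkin elimination of one variable. -/
theorem exists_multipliers_one (f : R →+* ℝ) (hf : StrictMono f) {I : Type*} [Fintype I]
    (a : I → R) :
    ∃ D : Finset (I → R), (∀ d ∈ D, (∀ i, 0 ≤ d i) ∧ ∑ i, d i * a i = 0) ∧
      ∀ h : I → ℝ, (∀ d ∈ D, 0 ≤ ∑ i, f (d i) * h i) → ∃ x : ℝ, ∀ i, 0 ≤ f (a i) * x + h i := by
  classical
  -- Inequalities free of `x` are kept. A lower and an upper bound for `x` are combined with weights
  -- `-a q` and `a p`, which cancels `x` without division, so the multipliers stay in `R`.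
  refine ⟨(Finset.univ.filter fun i => a i = 0).image (fun i => Pi.single i 1) ∪
    (Finset.univ.filter fun p : I × I => 0 < a p.1 ∧ a p.2 < 0).image
      (fun p => Pi.single p.1 (-a p.2) + Pi.single p.2 (a p.1)), ?_, ?_⟩
  · intro d hd
    simp only [Finset.mem_union, Finset.mem_image, Finset.mem_filter, Finset.mem_univ,
      true_and, Prod.exists] at hd
    rcases hd with ⟨i, hi, rfl⟩ | ⟨p, q, ⟨hp, hq⟩, rfl⟩
    · refine ⟨fun j => ?_, by simp [Pi.single_apply, hi]⟩
      exact (Pi.single_nonneg.2 zero_le_one : (0 : I → R) ≤ Pi.single i 1) j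
    · refine ⟨fun j => add_nonneg ?_ ?_, ?_⟩
      · exact (Pi.single_nonneg.2 (neg_nonneg.2 hq.le) : (0 : I → R) ≤ Pi.single p (-a q)) j
      · exact (Pi.single_nonneg.2 hp.le : (0 : I → R) ≤ Pi.single q (a p)) j
      · simp only [Pi.add_apply, add_mul, Finset.sum_add_distrib]
        simp [Pi.single_apply]
        ring
  · intro h hh
    have h0 : ∀ i, a i = 0 → 0 ≤ h i := fun i hi => by
      have := hh (Pi.single i 1) (by
        simp only [Finset.mem_union, Finset.mem_image, Finset.mem_filter, Finset.mem_univ,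
          true_and]
        exact Or.inl ⟨i, hi, rfl⟩)
      simpa [Pi.single_apply, apply_ite f] using this
    have h1 : ∀ p q, 0 < a p → a q < 0 → 0 ≤ -f (a q) * h p + f (a p) * h q := fun p q hp hq => by
      have := hh (Pi.single p (-a q) + Pi.single q (a p)) (by
        simp only [Finset.mem_union, Finset.mem_image, Finset.mem_filter, Finset.mem_univ,
          true_and]
        exact Or.inr ⟨(p, q), ⟨hp, hq⟩, rfl⟩)
      simpa [Pi.single_apply, apply_ite f, add_mul, Finset.sum_add_distrib] using this
    have fpos : ∀ {r}, 0 < r → 0 < f r := fun hr => by simpa using hf hr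
    have fneg : ∀ {r}, r < 0 → f r < 0 := fun hr => by simpa using hf hr
    let s : Set ℝ := (fun p => -h p / f (a p)) '' {p | 0 < a p}
    let t : Set ℝ := (fun p => -h p / f (a p)) '' {p | a p < 0}
    have key : ∃ x, x ∈ upperBounds s ∧ x ∈ lowerBounds t := by
      by_cases hs : s.Nonempty
      · by_cases ht : t.Nonempty
        · refine exists_between_of_forall_le hs ht ?_
          rintro _ ⟨p, hp, rfl⟩ _ ⟨q, hq, rfl⟩
          have hp' := fpos hp
          have hq' := fneg hq
          have := h1 p q hp hq
          simp only
          rw [div_le_iff₀ hp', div_mul_eq_mul_div, le_div_iff_of_neg hq']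
          linarith
        · obtain ⟨x, hx⟩ := ((Set.toFinite {p | 0 < a p}).image
            (fun p => -h p / f (a p))).bddAbove
          exact ⟨x, hx, fun y hy => (ht ⟨y, hy⟩).elim⟩
      · obtain ⟨x, hx⟩ := ((Set.toFinite {p | a p < 0}).image
          (fun p => -h p / f (a p))).bddBelow
        exact ⟨x, fun y hy => (hs ⟨y, hy⟩).elim, hx⟩
    obtain ⟨x, hxs, hxt⟩ := key
    refine ⟨x, fun i => ?_⟩
    rcases lt_trichotomy (a i) 0 with hi | hi | hi
    · have := hxt ⟨i, hi, rfl⟩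
      simp only at this
      rw [le_div_iff_of_neg (fneg hi)] at this
      linarith
    · simpa [hi] using h0 i hi
    · have := hxs ⟨i, hi, rfl⟩
      simp only at this
      rw [div_le_iff₀ (fpos hi)] at this
      linarith

/-- Fourier–Motzkin elimination: the solvability in `x` of the system `a x + h ≥ 0` is decided by
finitely many nonnegative combinations of the inequalities, which do not depend on `h` and whose
coefficients lie in the ring generated by the entries of `a`. -/
theorem exists_multipliers (f : R →+* ℝ) (hf : StrictMono f) {I : Type*} [Fintype I] (n : ℕ)
    (a : I → Fin n → R) :
    ∃ C : Finset (I → R), (∀ c ∈ C, (∀ i, 0 ≤ c i) ∧ ∀ j, ∑ i, c i * a i j = 0) ∧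
      ∀ h : I → ℝ, (∀ c ∈ C, 0 ≤ ∑ i, f (c i) * h i) →
        ∃ x : Fin n → ℝ, ∀ i, 0 ≤ ∑ j, f (a i j) * x j + h i := by
  classical
  induction n generalizing I with
  | zero =>
    refine ⟨Finset.univ.image fun i => Pi.single i 1, ?_, ?_⟩
    · intro c hc
      simp only [Finset.mem_image, Finset.mem_univ, true_and] at hc
      obtain ⟨i, rfl⟩ := hc
      exact ⟨fun j => (Pi.single_nonneg.2 zero_le_one : (0 : I → R) ≤ Pi.single i 1) j,
        fun j => j.elim0⟩
    · intro h hh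
      refine ⟨0, fun i => ?_⟩
      have := hh (Pi.single i 1) (Finset.mem_image_of_mem _ (Finset.mem_univ i))
      simpa [Pi.single_apply, apply_ite f] using this
  | succ n ih =>
    obtain ⟨D, hD, hDs⟩ := exists_multipliers_one f hf fun i => a i 0
    obtain ⟨C, hC, hCs⟩ := ih (fun (d : D) j => ∑ i, d.1 i * a i j.succ)
    -- Each `d ∈ D` is one inequality of the system with the first variable eliminated; composing
    -- with `C` expresses the final combinations in the original inequalities.
    refine ⟨C.image fun c i => ∑ d : D, c d * d.1 i, ?_, ?_⟩
    · intro c hc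
      obtain ⟨c, hcC, rfl⟩ := Finset.mem_image.1 hc
      refine ⟨fun i => Finset.sum_nonneg fun d _ =>
        mul_nonneg ((hC c hcC).1 d) ((hD d.1 d.2).1 i), fun j => ?_⟩
      have swap : ∑ i, (∑ d : D, c d * d.1 i) * a i j
          = ∑ d : D, c d * ∑ i, d.1 i * a i j := by
        simp only [Finset.sum_mul, Finset.mul_sum]
        rw [Finset.sum_comm]
        simp only [mul_assoc]
      rw [swap]
      refine Fin.cases ?_ (fun j => ?_) j
      · exact Finset.sum_eq_zero fun d _ => by rw [(hD d.1 d.2).2, mul_zero]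
      · exact (hC c hcC).2 j
    · intro h hh
      obtain ⟨y, hy⟩ := hCs (fun d => ∑ i, f (d.1 i) * h i) fun c hc => by
        have := hh _ (Finset.mem_image_of_mem _ hc)
        simp only [map_sum, map_mul, Finset.sum_mul] at this
        rw [Finset.sum_comm] at this
        simpa only [Finset.mul_sum, mul_assoc] using this
      obtain ⟨x, hx⟩ := hDs (fun i => ∑ j : Fin n, f (a i j.succ) * y j + h i) fun d hd => by
        have := hy ⟨d, hd⟩
        simp only [map_sum, map_mul, Finset.sum_mul] at this
        rw [Finset.sum_comm] at this
        simpa only [mul_add, Finset.sum_add_distrib, Finset.mul_sum, mul_assoc] using this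
      refine ⟨Fin.cons x y, fun i => ?_⟩
      have := hx i
      rw [Fin.sum_univ_succ]
      simpa [add_assoc] using this

end FourierMotzkin

/-! ### Faces of polyhedral cones, and fans generated by finitely many cones. -/

section Polyhedral

variable {V : Type*} [AddCommGroup V] [Module ℝ V]

/-- **Farkas' lemma** for finitely many functionals on a finite-dimensional real vector space. -/
theorem exists_nonneg_combination_of_nonneg [Module.Finite ℝ V] (L : Finset (Module.Dual ℝ V))
    (u : Module.Dual ℝ V) (hu : ∀ x, (∀ l ∈ L, 0 ≤ l x) → 0 ≤ u x) :
    ∃ c : L → ℝ, (∀ l, 0 ≤ c l) ∧ ∀ x, u x = ∑ l : L, c l * l.1 x := by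
  classical
  let b := Module.finBasis ℝ V
  obtain ⟨C, hC, hCs⟩ := exists_multipliers (RingHom.id ℝ) strictMono_id _
    (fun (i : Option L) j => i.elim (-u (b j)) fun l => l.1 (b j))
  -- Otherwise no multiplier obstructs the system `l x ≥ 0`, `u x ≤ -1`, and a solution would
  -- contradict `hu`.
  obtain ⟨c, hc, hneg⟩ : ∃ c ∈ C, 0 < c none := by
    by_contra! hcon
    obtain ⟨x, hx⟩ := hCs (fun i => i.elim (-1) fun _ => 0) fun c hc => by
      have := hcon c hc
      simp only [Fintype.sum_option, Option.elim_none, Option.elim_some, RingHom.id_apply]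
      simp
      linarith
    have hval : ∀ l : Module.Dual ℝ V, l (∑ j, x j • b j) = ∑ j, l (b j) * x j := fun l => by
      simp [mul_comm]
    have h1 := hu (∑ j, x j • b j) fun l hl => by
      have := hx (some ⟨l, hl⟩)
      rw [hval]
      simpa using this
    have h2 := hx none
    simp only [Option.elim_none, RingHom.id_apply, neg_mul, Finset.sum_neg_distrib] at h2
    rw [hval] at h1
    linarith
  refine ⟨fun l => c (some l) / c none, fun l => div_nonneg ((hC c hc).1 _) hneg.le, ?_⟩
  have : u = ∑ l : L, (c (some l) / c none) • l.1 := b.ext fun j => by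
    have := (hC c hc).2 j
    simp only [Fintype.sum_option, Option.elim_none, Option.elim_some] at this
    simp only [LinearMap.sum_apply, LinearMap.smul_apply, smul_eq_mul, div_mul_eq_mul_div,
      ← Finset.sum_div]
    rw [eq_div_iff hneg.ne']
    linarith
  intro x
  rw [this]
  simp

/-- The faces of a polyhedral cone are cut out by subsets of the defining inequalities. -/
theorem IsConeFace.exists_subset [Module.Finite ℝ V] {σ τ : PointedCone ℝ V}
    (h : IsConeFace τ σ) {L : Finset (Module.Dual ℝ V)} (hL : ∀ x, x ∈ σ ↔ ∀ u ∈ L, 0 ≤ u x) :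
    ∃ S ⊆ L, ∀ x, x ∈ τ ↔ x ∈ σ ∧ ∀ u ∈ S, u x = 0 := by
  classical
  obtain ⟨u, hu, hτ⟩ := h
  obtain ⟨c, hc, hcu⟩ := exists_nonneg_combination_of_nonneg L u fun x hx => hu x ((hL x).2 hx)
  -- On `σ` all terms of the combination are nonnegative, so `u` vanishes exactly where the
  -- functionals with positive coefficient do.
  refine ⟨(Finset.univ.filter fun l : L => 0 < c l).image Subtype.val, ?_, fun x => ?_⟩
  · intro l hl
    obtain ⟨l, -, rfl⟩ := Finset.mem_image.1 hl
    exact l.2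
  · rw [hτ, and_congr_right_iff]
    intro hx
    have hx' := (hL x).1 hx
    rw [hcu, Finset.sum_eq_zero_iff_of_nonneg fun l _ => mul_nonneg (hc l) (hx' l.1 l.2)]
    constructor
    · intro h l hl
      obtain ⟨l, hpos, rfl⟩ := Finset.mem_image.1 hl
      exact (mul_eq_zero.1 (h l (Finset.mem_univ l))).resolve_left (Finset.mem_filter.1 hpos).2.ne'
    · intro h l _
      rcases (hc l).eq_or_lt with h0 | h0
      · rw [← h0, zero_mul]
      · rw [h l.1 (Finset.mem_image_of_mem _ (Finset.mem_filter.2 ⟨Finset.mem_univ l, h0⟩)),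
          mul_zero]

/-- Functionals which are nonnegative on a cone cut out a face of it. -/
theorem isConeFace_of_forall_eq_zero {σ τ : PointedCone ℝ V} {S : Finset (Module.Dual ℝ V)}
    (hS : ∀ u ∈ S, ∀ x ∈ σ, 0 ≤ u x) (hτ : ∀ x, x ∈ τ ↔ x ∈ σ ∧ ∀ u ∈ S, u x = 0) :
    IsConeFace τ σ := by
  refine ⟨∑ u ∈ S, u, fun x hx => ?_, fun x => ?_⟩
  · rw [LinearMap.sum_apply]
    exact Finset.sum_nonneg fun u hu => hS u hu x hx
  · rw [hτ, and_congr_right_iff]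
    intro hx
    rw [LinearMap.sum_apply, Finset.sum_eq_zero_iff_of_nonneg fun u hu => hS u hu x hx]

theorem IsConeFace.refl (σ : PointedCone ℝ V) : IsConeFace σ σ :=
  ⟨0, by simp, by simp⟩

theorem IsConeFace.le {σ τ : PointedCone ℝ V} (h : IsConeFace τ σ) : τ ≤ σ := by
  obtain ⟨u, -, hu⟩ := h
  exact fun x hx => ((hu x).1 hx).1

/-- Intersecting with a subcone preserves faces. -/
theorem IsConeFace.inf_of_le {σ τ ρ : PointedCone ℝ V} (h : IsConeFace τ σ) (hρ : ρ ≤ σ) :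
    IsConeFace (ρ ⊓ τ) ρ := by
  obtain ⟨u, hu, hτ⟩ := h
  refine ⟨u, fun x hx => hu x (hρ hx), fun x => ?_⟩
  rw [Submodule.mem_inf, hτ]
  exact ⟨fun h => ⟨h.1, h.2.2⟩, fun h => ⟨h.1, hρ h.1, h.2⟩⟩

/-- A face of a face of a polyhedral cone is a face. -/
theorem IsConeFace.trans [Module.Finite ℝ V] {σ τ ρ : PointedCone ℝ V} (hσ : IsPolyhedralCone σ)
    (h₁ : IsConeFace ρ τ) (h₂ : IsConeFace τ σ) : IsConeFace ρ σ := by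
  classical
  obtain ⟨L, hL⟩ := hσ
  obtain ⟨S, hSL, hS⟩ := h₂.exists_subset hL
  have hτ : ∀ x, x ∈ τ ↔ ∀ u ∈ L ∪ S.image Neg.neg, 0 ≤ u x := fun x => by
    rw [hS, hL]
    simp only [Finset.mem_union, Finset.mem_image, or_imp, forall_and, forall_exists_index,
      and_imp, forall_apply_eq_imp_iff₂, LinearMap.neg_apply, Left.nonneg_neg_iff,
      and_congr_right_iff]
    exact fun h => ⟨fun h' u hu => (h' u hu).le, fun h' u hu => (h' u hu).antisymm (h u (hSL hu))⟩
  obtain ⟨S', hS'L, hS'⟩ := h₁.exists_subset hτ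
  -- Members of `S'` outside `L` are negatives of members of `S`, which already vanish on `τ`.
  refine isConeFace_of_forall_eq_zero (S := S ∪ S'.filter (· ∈ L)) (fun u hu x hx => ?_)
    fun x => ?_
  · have : u ∈ L := by
      rcases Finset.mem_union.1 hu with hu | hu
      · exact hSL hu
      · exact (Finset.mem_filter.1 hu).2
    exact (hL x).1 hx u this
  · rw [hS', hS, and_assoc, and_congr_right_iff]
    intro _
    simp only [Finset.mem_union, Finset.mem_filter, or_imp, forall_and, and_congr_right_iff]
    intro h
    refine ⟨fun h' u hu => h' u hu.1, fun h' u hu => ?_⟩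
    rcases Finset.mem_union.1 (hS'L hu) with hu' | hu'
    · exact h' u ⟨hu, hu'⟩
    · obtain ⟨v, hv, rfl⟩ := Finset.mem_image.1 hu'
      simp [h v hv]

/-- A polyhedral cone has finitely many faces. -/
theorem IsPolyhedralCone.finite_faces [Module.Finite ℝ V] {σ : PointedCone ℝ V}
    (hσ : IsPolyhedralCone σ) : {τ | IsConeFace τ σ}.Finite := by
  classical
  obtain ⟨L, hL⟩ := hσ
  choose! S hSL hS using fun τ (h : IsConeFace τ σ) => h.exists_subset hL
  refine Set.Finite.of_finite_image (f := S)
    ((Finset.finite_toSet L.powerset).subset ?_) fun τ hτ τ' hτ' h => ?_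
  · rintro _ ⟨τ, hτ, rfl⟩
    exact Finset.mem_coe.2 (Finset.mem_powerset.2 (hSL τ hτ))
  · ext x
    rw [hS τ hτ, hS τ' hτ', h]

/-- The faces of finitely many strongly convex polyhedral cones form a fan as soon as the cones
themselves intersect in common faces. -/
theorem isFan_faces [Module.Finite ℝ V] {F : Set (PointedCone ℝ V)} (hfin : F.Finite)
    (hne : F.Nonempty) (hpoly : ∀ σ ∈ F, IsPolyhedralCone σ)
    (hface : ∀ τ, ∀ σ ∈ F, IsConeFace τ σ → IsPolyhedralCone τ)
    (hconv : ∀ σ ∈ F, IsStronglyConvex σ) (hint : ∀ σ ∈ F, ∀ τ ∈ F, IsConeFace (σ ⊓ τ) σ) :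
    IsFan {τ | ∃ σ ∈ F, IsConeFace τ σ} := by
  have inter : ∀ σ ∈ F, ∀ σ' ∈ F, ∀ τ τ', IsConeFace τ σ → IsConeFace τ' σ' →
      IsConeFace (τ ⊓ τ') τ := fun σ hσ σ' hσ' τ τ' h h' => by
    -- The cone `σ ⊓ σ' ⊓ τ'` is a face of `σ ⊓ σ'`, hence of `σ`; cutting it with `τ` gives `τ ⊓
    -- τ'`.
    have h1 : IsConeFace (σ ⊓ σ' ⊓ τ') (σ ⊓ σ') := h'.inf_of_le inf_le_right
    have h2 := (h1.trans (hpoly σ hσ) (hint σ hσ σ' hσ')).inf_of_le h.le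
    have : τ ⊓ (σ ⊓ σ' ⊓ τ') = τ ⊓ τ' := by
      apply le_antisymm
      · exact le_inf inf_le_left (inf_le_right.trans inf_le_right)
      · exact le_inf inf_le_left (le_inf (le_inf (inf_le_left.trans h.le)
          (inf_le_right.trans h'.le)) inf_le_right)
    rwa [this] at h2
  refine ⟨?_, ?_, ?_, ?_, ?_, ?_⟩
  · have : {τ | ∃ σ ∈ F, IsConeFace τ σ} = ⋃ σ ∈ F, {τ | IsConeFace τ σ} := by
      ext; simp
    rw [this]
    exact hfin.biUnion fun σ hσ => (hpoly σ hσ).finite_faces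
  · obtain ⟨σ, hσ⟩ := hne
    exact ⟨σ, σ, hσ, .refl σ⟩
  · rintro τ ⟨σ, hσ, h⟩
    exact hface τ σ hσ h
  · rintro τ ⟨σ, hσ, h⟩ x hx hx0 hx'
    exact hconv σ hσ x (h.le hx) hx0 (h.le hx')
  · rintro τ ⟨σ, hσ, h⟩ ρ hρ
    exact ⟨σ, hσ, hρ.trans (hpoly σ hσ) h⟩
  · rintro τ ⟨σ, hσ, h⟩ τ' ⟨σ', hσ', h'⟩
    refine ⟨inter σ hσ σ' hσ' τ τ' h h', ?_⟩
    rw [inf_comm]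
    exact inter σ' hσ' σ hσ τ' τ h' h

end Polyhedral

/-! ### Rational cones, and extending implications from the ray to a half-space. -/

section Rational

variable {N : Type*} [AddCommGroup N] {k : ℕ}

/-- The functional `(w, ξ) ↦ ⟨u, w⟩ + f · ξ` on `N_ℝ × ℝ^k` given by `(u, f) ∈ M × ℤ^k`. -/
noncomputable def rationalFunctional (y : Module.Dual ℤ N × (Fin k → ℤ)) :
    Module.Dual ℝ ((ℝ ⊗[ℤ] N) × (Fin k → ℝ)) :=
  (latticePairing y.1).comp (LinearMap.fst ℝ _ _) +
    (∑ i, (y.2 i : ℝ) • LinearMap.proj i).comp (LinearMap.snd ℝ _ _)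

theorem rationalFunctional_apply (y : Module.Dual ℤ N × (Fin k → ℤ))
    (x : (ℝ ⊗[ℤ] N) × (Fin k → ℝ)) :
    rationalFunctional y x = latticePairing y.1 x.1 + ∑ i, (y.2 i : ℝ) * x.2 i := by
  simp [rationalFunctional]

theorem rationalFunctional_add (y z : Module.Dual ℤ N × (Fin k → ℤ)) :
    rationalFunctional (y + z) = rationalFunctional y + rationalFunctional z := by
  ext1
  · ext; simp [rationalFunctional, latticePairing]
  · ext; simp [rationalFunctional, add_mul, Finset.sum_add_distrib]

variable (N k) in
/-- `rationalFunctional` as a homomorphism. -/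
noncomputable def rationalFunctionalHom : (Module.Dual ℤ N × (Fin k → ℤ)) →+
    Module.Dual ℝ ((ℝ ⊗[ℤ] N) × (Fin k → ℝ)) :=
  AddMonoidHom.mk' rationalFunctional rationalFunctional_add

theorem rationalFunctional_neg (y : Module.Dual ℤ N × (Fin k → ℤ)) :
    rationalFunctional (-y) = -rationalFunctional y :=
  map_neg (rationalFunctionalHom N k) y

theorem rationalFunctional_sum (S : Finset (Module.Dual ℤ N × (Fin k → ℤ))) :
    rationalFunctional (∑ y ∈ S, y) = ∑ y ∈ S, rationalFunctional y :=
  map_sum (rationalFunctionalHom N k) _ S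

/-- The rational cone `L^∨` in `N_ℝ × ℝ^k`. -/
noncomputable def rationalCone (L : Finset (Module.Dual ℤ N × (Fin k → ℤ))) :
    PointedCone ℝ ((ℝ ⊗[ℤ] N) × (Fin k → ℝ)) where
  carrier := {x | ∀ y ∈ L, 0 ≤ rationalFunctional y x}
  zero_mem' := by simp
  add_mem' hx hx' y hy := by
    rw [map_add]
    exact add_nonneg (hx y hy) (hx' y hy)
  smul_mem' c x hx y hy := by
    have : c • x = (c : ℝ) • x := rfl
    rw [this, map_smul]
    exact smul_nonneg c.2 (hx y hy)

theorem mem_rationalCone {L : Finset (Module.Dual ℤ N × (Fin k → ℤ))}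
    {x : (ℝ ⊗[ℤ] N) × (Fin k → ℝ)} :
    x ∈ rationalCone L ↔ ∀ y ∈ L, 0 ≤ rationalFunctional y x := Iff.rfl

theorem IsRationalCone.isPolyhedralCone {σ : PointedCone ℝ ((ℝ ⊗[ℤ] N) × (Fin k → ℝ))}
    (h : IsRationalCone σ) : IsPolyhedralCone σ := by
  classical
  obtain ⟨L, hL⟩ := h
  exact ⟨L.image rationalFunctional, fun x => by
    rw [hL, Finset.forall_mem_image]; simp only [rationalFunctional_apply]⟩

/-- The pairing in terms of a basis of the lattice. -/
theorem latticePairing_eq_sum {n : ℕ} (b : Module.Basis (Fin n) ℤ N) (u : Module.Dual ℤ N)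
    (w : ℝ ⊗[ℤ] N) :
    latticePairing u w = ∑ j, (u (b j) : ℝ) * (b.baseChange ℝ).repr w j := by
  conv_lhs => rw [← (b.baseChange ℝ).sum_repr w]
  simp [latticePairing_tmul, mul_comm]

/-- A face of a rational cone is rational. -/
theorem IsConeFace.isRationalCone [Module.Finite ℤ N] {L : Finset (Module.Dual ℤ N × (Fin k → ℤ))}
    {τ : PointedCone ℝ ((ℝ ⊗[ℤ] N) × (Fin k → ℝ))} (h : IsConeFace τ (rationalCone L)) :
    IsRationalCone τ := by
  classical
  obtain ⟨S, hSL, hS⟩ := h.exists_subset (L := L.image rationalFunctional)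
    fun x => by rw [mem_rationalCone, Finset.forall_mem_image]
  refine ⟨L ∪ (L.filter (rationalFunctional · ∈ S)).image Neg.neg, fun x => ?_⟩
  simp only [← rationalFunctional_apply]
  rw [hS, mem_rationalCone]
  simp only [Finset.forall_mem_union, Finset.forall_mem_image, Finset.mem_filter,
    rationalFunctional_neg, LinearMap.neg_apply, Left.nonneg_neg_iff, and_congr_right_iff]
  refine fun h => ⟨fun h' y hy => (h' _ hy.2).le, fun h' u hu => ?_⟩
  obtain ⟨y, hy, rfl⟩ := Finset.mem_image.1 (hSL hu)
  exact (h' ⟨hy, hu⟩).antisymm (h y hy)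

/-- Let `e ∈ ℝ^k` lie on no rational hyperplane. If the inequality `y ≥ 0` follows from the
inequalities `l ≥ 0`, `l ∈ L`, over the ray `ℝ_{≥0} e`, then it follows from them over a
rational half-space of `ℝ^k` having `e` in its interior. -/
theorem exists_halfspace_of_nonneg [Module.Free ℤ N] [Module.Finite ℤ N] {e : Fin k → ℝ}
    (he : ∀ g : Fin k → ℤ, ∑ i, (g i : ℝ) * e i = 0 → g = 0)
    (hpos : ∃ s : Fin k → ℤ, 0 < ∑ i, (s i : ℝ) * e i)
    (L : Finset (Module.Dual ℤ N × (Fin k → ℤ))) (y : Module.Dual ℤ N × (Fin k → ℤ))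
    (h : ∀ (w : ℝ ⊗[ℤ] N) (t : ℝ), 0 ≤ t → (∀ l ∈ L, 0 ≤ rationalFunctional l (w, t • e)) →
      0 ≤ rationalFunctional y (w, t • e)) :
    ∃ g : Fin k → ℤ, 0 < ∑ i, (g i : ℝ) * e i ∧ ∀ z, (∀ l ∈ L, 0 ≤ rationalFunctional l z) →
      0 ≤ ∑ i, (g i : ℝ) * z.2 i → 0 ≤ rationalFunctional y z := by
  classical
  let b := Module.finBasis ℤ N
  let p : (Fin k → ℤ) → ℝ := fun g => ∑ i, (g i : ℝ) * e i
  have hF : ∀ (l : Module.Dual ℤ N × (Fin k → ℤ)) (w : ℝ ⊗[ℤ] N) (t : ℝ),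
      rationalFunctional l (w, t • e) = latticePairing l.1 w + t * p l.2 := fun l w t => by
    rw [rationalFunctional_apply, Finset.mul_sum]
    congr 1
    exact Finset.sum_congr rfl fun i _ => by simp; ring
  obtain ⟨C, hC, hCs⟩ := exists_multipliers (Int.castRingHom ℝ) Int.cast_strictMono _
    (fun (i : Option L) j => i.elim (-y.1 (b j)) fun l => l.1.1 (b j))
  -- At each height `t` the system `l ≥ 0`, `y ≤ -1` has no solution, so some integral multiplier
  -- refutes it.
  have hinf : ∀ t : ℝ, 0 ≤ t → ∃ c ∈ C,
      ∑ l : L, (c (some l) : ℝ) * (t * p l.1.2) < c none * (t * p y.2 + 1) := fun t ht => by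
    by_contra! hcon
    obtain ⟨x, hx⟩ := hCs (fun i => i.elim (-(t * p y.2) - 1) fun l => t * p l.1.2)
      fun c hc => by
        have := hcon c hc
        simp only [Fintype.sum_option, Option.elim_none, Option.elim_some, eq_intCast]
        linarith
    have hval : ∀ u : Module.Dual ℤ N, latticePairing u ((b.baseChange ℝ).equivFun.symm x)
        = ∑ j, (u (b j) : ℝ) * x j := fun u => by
      rw [latticePairing_eq_sum b]
      exact Finset.sum_congr rfl fun j _ => by
        rw [← Module.Basis.equivFun_apply, LinearEquiv.apply_symm_apply]
    have h1 := h ((b.baseChange ℝ).equivFun.symm x) t ht fun l hl => by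
      have := hx (some ⟨l, hl⟩)
      rw [hF, hval]
      simpa using this
    have h2 := hx none
    rw [hF, hval] at h1
    simp only [Option.elim_none, eq_intCast, Int.cast_neg, neg_mul,
      Finset.sum_neg_distrib] at h2
    linarith
  -- integral multipliers deriving `y` from `L` up to a nonnegative multiple of the height
  obtain ⟨c, hc, hc0, hcy, hcp⟩ : ∃ c : Option L → ℤ, (∀ i, 0 ≤ c i) ∧ 0 < c none ∧
      (∀ j, ∑ l : L, c (some l) * l.1.1 (b j) = c none * y.1 (b j)) ∧
      ∑ l : L, (c (some l) : ℝ) * p l.1.2 ≤ c none * p y.2 := by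
    have hC' : ∀ c ∈ C, ∀ j, ∑ l : L, c (some l) * l.1.1 (b j) = c none * y.1 (b j) :=
      fun c hc j => by
        have := (hC c hc).2 j
        simp only [Fintype.sum_option, Option.elim_none, Option.elim_some] at this
        linarith
    -- At height zero the refutation says precisely that `c₀ none` is positive.
    obtain ⟨c₀, hc₀, hc₀'⟩ := hinf 0 le_rfl
    have hc₀n : 0 < c₀ none := by simpa using hc₀'
    by_cases hex : ∃ c ∈ C, 0 < c none ∧ ∑ l : L, (c (some l) : ℝ) * p l.1.2 ≤ c none * p y.2
    · obtain ⟨c, hc, h0, hp⟩ := hex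
      exact ⟨c, (hC c hc).1, h0, hC' c hc, hp⟩
    push Not at hex
    -- Now a multiplier with `c none > 0` refutes the system only at bounded heights. At large `t`
    -- the refutation must have `c none = 0`, so `L` alone is inconsistent at positive height.
    -- Adding a large multiple of `c₁` to `c₀` then gives the required sign.
    obtain ⟨c₁, hc₁, hc₁n, hc₁p⟩ : ∃ c ∈ C, c none = 0 ∧
        ∑ l : L, (c (some l) : ℝ) * p l.1.2 < 0 := by
      by_contra! hcon
      have : ∀ᶠ t : ℝ in Filter.atTop, 0 ≤ t ∧ ∀ c ∈ C,
          (c none : ℝ) * (t * p y.2 + 1) ≤ ∑ l : L, (c (some l) : ℝ) * (t * p l.1.2) := by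
        refine (Filter.eventually_ge_atTop 0).and ((Filter.eventually_all_finset C).2 ?_)
        intro c hc
        have hmul : ∀ t : ℝ, ∑ l : L, (c (some l) : ℝ) * (t * p l.1.2)
            = t * ∑ l : L, (c (some l) : ℝ) * p l.1.2 := fun t => by
          rw [Finset.mul_sum]
          exact Finset.sum_congr rfl fun l _ => by ring
        rcases ((hC c hc).1 none).eq_or_lt with h0 | h0
        · filter_upwards [Filter.eventually_ge_atTop 0] with t ht
          rw [← h0, hmul, Int.cast_zero, zero_mul]
          exact mul_nonneg ht (hcon c hc h0.symm)
        · have hlt := sub_pos.2 (hex c hc h0)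
          filter_upwards [Filter.eventually_ge_atTop ((c none : ℝ) /
            (∑ l : L, (c (some l) : ℝ) * p l.1.2 - c none * p y.2))] with t ht
          rw [div_le_iff₀ hlt] at ht
          rw [hmul]
          linarith
      obtain ⟨t, ht, hall⟩ := this.exists
      obtain ⟨c, hc, hlt⟩ := hinf t ht
      exact (hall c hc).not_gt hlt
    obtain ⟨m, hm⟩ := exists_nat_ge
      ((∑ l : L, (c₀ (some l) : ℝ) * p l.1.2 - c₀ none * p y.2) /
        -∑ l : L, (c₁ (some l) : ℝ) * p l.1.2)
    rw [div_le_iff₀ (neg_pos.2 hc₁p)] at hm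
    refine ⟨fun i => c₀ i + m * c₁ i, fun i => ?_, by simpa [hc₁n] using hc₀n, fun j => ?_, ?_⟩
    · have := (hC c₀ hc₀).1 i
      have := (hC c₁ hc₁).1 i
      positivity
    · simp only [add_mul, Finset.sum_add_distrib, mul_assoc, ← Finset.mul_sum, hC' c₀ hc₀ j,
        hC' c₁ hc₁ j]
    · push_cast
      simp only [add_mul, Finset.sum_add_distrib, mul_assoc, ← Finset.mul_sum, hc₁n]
      simp only [Int.cast_zero, zero_mul, mul_zero, add_zero]
      linarith
  have hc0' : (0 : ℝ) < c none := by exact_mod_cast hc0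
  -- The defect in the combination: `c none * y` is the combination of `L` plus `g · ξ`, with `w`
  -- eliminated.
  let g : Fin k → ℤ := fun i => c none * y.2 i - ∑ l : L, c (some l) * l.1.2 i
  have hgsum : ∀ ξ : Fin k → ℝ, ∑ i, (g i : ℝ) * ξ i =
      c none * ∑ i, (y.2 i : ℝ) * ξ i - ∑ l : L, (c (some l) : ℝ) * ∑ i, (l.1.2 i : ℝ) * ξ i :=
    fun ξ => by
      simp only [g, Int.cast_sub, Int.cast_sum, Int.cast_mul, sub_mul, Finset.sum_sub_distrib,
        Finset.sum_mul, Finset.mul_sum, mul_assoc]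
      rw [Finset.sum_comm]
  have hgz : ∀ z, (∀ l ∈ L, 0 ≤ rationalFunctional l z) → 0 ≤ ∑ i, (g i : ℝ) * z.2 i →
      0 ≤ rationalFunctional y z := fun z hz hg => by
    have hpair : c none * latticePairing y.1 z.1
        = ∑ l : L, (c (some l) : ℝ) * latticePairing l.1.1 z.1 := by
      simp only [latticePairing_eq_sum b, Finset.mul_sum]
      rw [Finset.sum_comm]
      refine Finset.sum_congr rfl fun j _ => ?_
      have := congrArg (Int.cast : ℤ → ℝ) (hcy j)
      push_cast at this
      simp only [← mul_assoc, ← Finset.sum_mul, this]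
    have hsum : 0 ≤ ∑ l : L, (c (some l) : ℝ) * rationalFunctional l.1 z :=
      Finset.sum_nonneg fun l _ => mul_nonneg (by exact_mod_cast hc _) (hz l.1 l.2)
    simp only [rationalFunctional_apply, mul_add, Finset.sum_add_distrib, ← hpair] at hsum
    rw [hgsum] at hg
    refine nonneg_of_mul_nonneg_right (b := rationalFunctional y z) ?_ hc0'
    rw [rationalFunctional_apply, mul_add]
    linarith
  -- If `g · e = 0`, independence forces `g = 0`; no condition on `ξ` is then needed and any
  -- half-space around `e` serves.
  rcases (show 0 ≤ ∑ i, (g i : ℝ) * e i by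
    rw [hgsum]; exact sub_nonneg.2 hcp).eq_or_lt with h0 | h0
  · obtain ⟨s, hs⟩ := hpos
    refine ⟨s, hs, fun z hz _ => hgz z hz ?_⟩
    simp [he g h0.symm]
  · exact ⟨g, h0, hgz⟩

end Rational

/-! ### Lifting an admissible fan to a rational fan. -/

section Lift

variable {N : Type*} [AddCommGroup N] {k : ℕ}

/-- The rational cone in `N_ℝ × ℝ^k` cut out by `L` over the cone `𝒢^∨` of `ℝ^k`. -/
noncomputable def rationalConeOver (L : Finset (Module.Dual ℤ N × (Fin k → ℤ)))
    (𝒢 : Finset (Fin k → ℤ)) : PointedCone ℝ ((ℝ ⊗[ℤ] N) × (Fin k → ℝ)) :=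
  letI := Classical.decEq (Module.Dual ℤ N × (Fin k → ℤ))
  rationalCone (L ∪ 𝒢.image (Prod.mk 0))

theorem mem_rationalConeOver {L : Finset (Module.Dual ℤ N × (Fin k → ℤ))}
    {𝒢 : Finset (Fin k → ℤ)} {z : (ℝ ⊗[ℤ] N) × (Fin k → ℝ)} :
    z ∈ rationalConeOver L 𝒢 ↔ (∀ l ∈ L, 0 ≤ rationalFunctional l z) ∧
      ∀ g ∈ 𝒢, 0 ≤ ∑ i, (g i : ℝ) * z.2 i := by
  simp only [rationalConeOver, mem_rationalCone, Finset.forall_mem_union, Finset.forall_mem_image]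
  simp [rationalFunctional_apply, latticePairing]

theorem rationalFunctional_apply_smul (y : Module.Dual ℤ N × (Fin k → ℤ)) (w : ℝ ⊗[ℤ] N) (t : ℝ)
    (e : Fin k → ℝ) :
    rationalFunctional y (w, t • e) = latticePairing y.1 w + (∑ i, (y.2 i : ℝ) * e i) * t := by
  rw [rationalFunctional_apply, Finset.sum_mul]
  congr 1
  exact Finset.sum_congr rfl fun i _ => by simp; ring

/-- If every element of `Γ` has a multiple which is an integral combination of the `e i`, then a
`Γ`-admissible cone is the preimage of a rational cone in `N_ℝ × ℝ^k`. -/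
theorem IsAdmissibleCone.exists_lift {Γ : AddSubgroup ℝ} {e : Fin k → ℝ}
    (hΓ : ∀ γ ∈ Γ, ∃ n : ℕ, 0 < n ∧ ∃ f : Fin k → ℤ, n * γ = ∑ i, (f i : ℝ) * e i)
    {σ : PointedCone ℝ ((ℝ ⊗[ℤ] N) × ℝ)} (hσ : IsAdmissibleCone Γ σ) :
    ∃ L : Finset (Module.Dual ℤ N × (Fin k → ℤ)), ∀ x, x ∈ σ ↔
      0 ≤ x.2 ∧ ∀ y ∈ L, 0 ≤ rationalFunctional y (x.1, x.2 • e) := by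
  classical
  obtain ⟨-, L, hL⟩ := hσ
  choose n hn f hf using fun γ : Γ => hΓ γ.1 γ.2
  refine ⟨L.image fun y => (n y.2 • y.1, f y.2), fun x => ?_⟩
  rw [hL, and_congr_right_iff, Finset.forall_mem_image]
  refine fun _ => forall₂_congr fun y _ => ?_
  have : rationalFunctional (n y.2 • y.1, f y.2) (x.1, x.2 • e) =
      n y.2 * (latticePairing y.1 x.1 + y.2 * x.2) := by
    rw [rationalFunctional_apply_smul, ← hf]
    simp [latticePairing]
    ring
  rw [this, mul_nonneg_iff_of_pos_left (by exact_mod_cast hn y.2)]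

variable [Module.Free ℤ N] [Module.Finite ℤ N]

/-- Each inequality in `L'` costs one half-space; their finite intersection still has `e` in its
interior. -/
theorem exists_finset_of_nonneg {e : Fin k → ℝ}
    (he : ∀ g : Fin k → ℤ, ∑ i, (g i : ℝ) * e i = 0 → g = 0)
    (hpos : ∃ s : Fin k → ℤ, 0 < ∑ i, (s i : ℝ) * e i)
    (L L' : Finset (Module.Dual ℤ N × (Fin k → ℤ)))
    (h : ∀ (w : ℝ ⊗[ℤ] N) (t : ℝ), 0 ≤ t → (∀ l ∈ L, 0 ≤ rationalFunctional l (w, t • e)) →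
      ∀ y ∈ L', 0 ≤ rationalFunctional y (w, t • e)) :
    ∃ 𝒢 : Finset (Fin k → ℤ), (∀ g ∈ 𝒢, 0 < ∑ i, (g i : ℝ) * e i) ∧
      ∀ z, (∀ l ∈ L, 0 ≤ rationalFunctional l z) → (∀ g ∈ 𝒢, 0 ≤ ∑ i, (g i : ℝ) * z.2 i) →
        ∀ y ∈ L', 0 ≤ rationalFunctional y z := by
  classical
  choose! g hg hgz using fun y (hy : y ∈ L') =>
    exists_halfspace_of_nonneg he hpos L y fun w t ht hl => h w t ht hl y hy
  refine ⟨L'.image g, ?_, fun z hz hgz' y hy => ?_⟩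
  · rwa [Finset.forall_mem_image]
  · rw [Finset.forall_mem_image] at hgz'
    exact hgz y hy z hz (hgz' hy)

/-- If two cones over the ray `ℝ_{≥0} e` intersect in a face of the first one, then so do their
lifts over every sufficiently small rational cone around `e`. -/
theorem exists_finset_isConeFace_inf {e : Fin k → ℝ}
    (he : ∀ g : Fin k → ℤ, ∑ i, (g i : ℝ) * e i = 0 → g = 0) {s : Fin k → ℤ}
    (hs : 0 < ∑ i, (s i : ℝ) * e i) {σ τ : PointedCone ℝ ((ℝ ⊗[ℤ] N) × ℝ)}
    {L L' : Finset (Module.Dual ℤ N × (Fin k → ℤ))}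
    (hσ : ∀ x, x ∈ σ ↔ ∀ y ∈ L, 0 ≤ rationalFunctional y (x.1, x.2 • e))
    (hτ : ∀ x, x ∈ τ ↔ ∀ y ∈ L', 0 ≤ rationalFunctional y (x.1, x.2 • e))
    (hface : IsConeFace (σ ⊓ τ) σ) :
    ∃ 𝒢 : Finset (Fin k → ℤ), (∀ g ∈ 𝒢, 0 < ∑ i, (g i : ℝ) * e i) ∧ ∀ 𝒢', 𝒢 ⊆ 𝒢' →
      IsConeFace (rationalConeOver L 𝒢' ⊓ rationalConeOver L' 𝒢') (rationalConeOver L 𝒢') := by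
  classical
  let φ : (ℝ ⊗[ℤ] N) × ℝ →ₗ[ℝ] (ℝ ⊗[ℤ] N) × (Fin k → ℝ) :=
    LinearMap.prodMap LinearMap.id (LinearMap.toSpanSingleton ℝ _ e)
  let r : Module.Dual ℤ N × (Fin k → ℤ) → Module.Dual ℝ ((ℝ ⊗[ℤ] N) × ℝ) :=
    fun y => (rationalFunctional y).comp φ
  obtain ⟨S, hSL, hS⟩ := hface.exists_subset (L := L.image r) fun x => by
    rw [hσ, Finset.forall_mem_image]; rfl
  -- The functional supplied by `hface` is merely real. This sum of members of `L` cuts out the same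
  -- face and is rational, so it makes sense on the lifts.
  let y := ∑ l ∈ L.filter (r · ∈ S), l
  have hy : ∀ z, rationalFunctional y z = ∑ l ∈ L.filter (r · ∈ S), rationalFunctional l z :=
    fun z => by rw [rationalFunctional_sum, LinearMap.sum_apply]
  have hy0 : ∀ z, (∀ l ∈ L, 0 ≤ rationalFunctional l z) → 0 ≤ rationalFunctional y z :=
    fun z hz => by
      rw [hy]
      exact Finset.sum_nonneg fun l hl => hz l (Finset.mem_filter.1 hl).1
  have hinf : ∀ x, x ∈ σ → (x ∈ τ ↔ rationalFunctional y (x.1, x.2 • e) = 0) := fun x hx => by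
    have h1 := hS x
    rw [Submodule.mem_inf, and_congr_right_iff] at h1
    rw [h1 hx, hy, Finset.sum_eq_zero_iff_of_nonneg fun l hl =>
      (hσ x).1 hx l (Finset.mem_filter.1 hl).1]
    constructor
    · exact fun h l hl => h _ (Finset.mem_filter.1 hl).2
    · intro h u hu
      obtain ⟨l, hl, rfl⟩ := Finset.mem_image.1 (hSL hu)
      exact h l (Finset.mem_filter.2 ⟨hl, hu⟩)
  -- `𝒢₁` makes `y = 0` on the first lift imply membership in the second; `𝒢₂` gives the converse.
  obtain ⟨𝒢₁, h𝒢₁, h₁⟩ := exists_finset_of_nonneg he ⟨s, hs⟩ (insert (-y) L) L'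
    fun w t _ hl => by
      rw [Finset.forall_mem_insert, rationalFunctional_neg, LinearMap.neg_apply,
        Left.nonneg_neg_iff] at hl
      have hx : (w, t) ∈ σ := (hσ _).2 hl.2
      exact (hτ _).1 ((hinf _ hx).2 (hl.1.antisymm (hy0 _ hl.2)))
  obtain ⟨𝒢₂, h𝒢₂, h₂⟩ := exists_finset_of_nonneg he ⟨s, hs⟩ (L ∪ L') {-y} fun w t _ hl => by
    rw [Finset.forall_mem_union] at hl
    have hx : (w, t) ∈ σ := (hσ _).2 hl.1
    simp only [Finset.mem_singleton, forall_eq, rationalFunctional_neg, LinearMap.neg_apply,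
      Left.nonneg_neg_iff]
    exact ((hinf _ hx).1 ((hτ _).2 hl.2)).le
  refine ⟨𝒢₁ ∪ 𝒢₂, Finset.forall_mem_union.2 ⟨h𝒢₁, h𝒢₂⟩, fun 𝒢' h𝒢' => ?_⟩
  rw [Finset.union_subset_iff] at h𝒢'
  refine ⟨rationalFunctional y, fun z hz => hy0 z (mem_rationalConeOver.1 hz).1, fun z => ?_⟩
  rw [Submodule.mem_inf, and_congr_right_iff]
  intro hz
  rw [mem_rationalConeOver] at hz ⊢
  constructor
  · intro hz'
    refine le_antisymm ?_ (hy0 z hz.1)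
    have := h₂ z (Finset.forall_mem_union.2 ⟨hz.1, hz'.1⟩) fun g hg => hz.2 g (h𝒢'.2 hg)
    simpa only [Finset.mem_singleton, forall_eq, rationalFunctional_neg, LinearMap.neg_apply,
      Left.nonneg_neg_iff] using this
  · refine fun h0 => ⟨h₁ z ?_ fun g hg => hz.2 g (h𝒢'.1 hg), hz.2⟩
    rw [Finset.forall_mem_insert, rationalFunctional_neg, LinearMap.neg_apply, h0, neg_zero]
    exact ⟨le_rfl, hz.1⟩

/-- If `e ∈ ℝ^k` has linearly independent coordinates whose rational span contains `Γ`, then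
every `Γ`-admissible fan is the pullback of a rational fan along `ι : 1 ↦ e`. -/
theorem IsAdmissibleFan.exists_isRationalFan {Γ : AddSubgroup ℝ} (hk : 0 < k)
    {ι : ℝ →ₗ[ℝ] (Fin k → ℝ)} (he : ∀ g : Fin k → ℤ, ∑ i, (g i : ℝ) * ι 1 i = 0 → g = 0)
    (hΓ : ∀ γ ∈ Γ, ∃ n : ℕ, 0 < n ∧ ∃ f : Fin k → ℤ, n * γ = ∑ i, (f i : ℝ) * ι 1 i)
    {F : Set (PointedCone ℝ ((ℝ ⊗[ℤ] N) × ℝ))} (hF : IsAdmissibleFan Γ F) :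
    ∃ G : Set (PointedCone ℝ ((ℝ ⊗[ℤ] N) × (Fin k → ℝ))),
      IsRationalFan G ∧ F = fanPullback (idProd N ι) G := by
  classical
  have hφ : ∀ x : (ℝ ⊗[ℤ] N) × ℝ, idProd N ι x = (x.1, x.2 • ι 1) := fun x => by
    rw [← map_smul, smul_eq_mul, mul_one]; rfl
  generalize ι 1 = e at *
  have he0 : ∀ i, e i ≠ 0 := fun i hi => by
    have := congrFun (he (Pi.single i 1) (by simp [Pi.single_apply, hi])) i
    simp at this
  let s : Fin k → ℤ := fun i => if 0 < e i then 1 else -1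
  have hse : ∀ i, 0 < (s i : ℝ) * e i := fun i => by
    by_cases h : 0 < e i
    · simp [s, h]
    · simpa [s, h] using lt_of_le_of_ne (not_lt.1 h) (he0 i)
  have hs : 0 < ∑ i, (s i : ℝ) * e i :=
    Finset.sum_pos (fun i _ => hse i) ⟨⟨0, hk⟩, Finset.mem_univ _⟩
  have hlift : ∀ σ ∈ F, ∃ L : Finset (Module.Dual ℤ N × (Fin k → ℤ)),
      ∀ x, x ∈ σ ↔ ∀ y ∈ L, 0 ≤ rationalFunctional y (x.1, x.2 • e) := fun σ hσ => by
    obtain ⟨L, hL⟩ := (hF.admissible σ hσ).exists_lift hΓ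
    -- Since `s · e > 0`, the inequality `(0, s)` encodes `t ≥ 0`.
    refine ⟨insert (0, s) L, fun x => ?_⟩
    rw [hL, Finset.forall_mem_insert, rationalFunctional_apply_smul (0, s)]
    simp [latticePairing, mul_nonneg_iff_of_pos_left hs]
  choose! L hL using hlift
  choose! 𝒢 h𝒢 h𝒢face using fun (σ τ : PointedCone ℝ ((ℝ ⊗[ℤ] N) × ℝ)) (h : σ ∈ F ∧ τ ∈ F) =>
    exists_finset_isConeFace_inf he hs (hL σ h.1) (hL τ h.2)
      (hF.isFan.inter_face σ h.1 τ h.2).1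
  let Ff := hF.isFan.finite.toFinset
  have hFf : ∀ {σ}, σ ∈ Ff ↔ σ ∈ F := hF.isFan.finite.mem_toFinset
  -- The signed coordinates confine `ξ` to the orthant of `e`. A line in a lift would thus lie over
  -- `ξ = 0`, hence in `σ`.
  let 𝒢' : Finset (Fin k → ℤ) := (Finset.univ.image fun i => Pi.single i (s i)) ∪
    (Ff ×ˢ Ff).biUnion fun p => 𝒢 p.1 p.2
  have h𝒢'pos : ∀ g ∈ 𝒢', 0 < ∑ i, (g i : ℝ) * e i := fun g hg => by
    rcases Finset.mem_union.1 hg with hg | hg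
    · obtain ⟨i, -, rfl⟩ := Finset.mem_image.1 hg
      simpa [Pi.single_apply] using hse i
    · obtain ⟨p, hp, hg⟩ := Finset.mem_biUnion.1 hg
      rw [Finset.mem_product, hFf, hFf] at hp
      exact h𝒢 p.1 p.2 hp g hg
  have hsz : ∀ z : (ℝ ⊗[ℤ] N) × (Fin k → ℝ), (∀ g ∈ 𝒢', 0 ≤ ∑ i, (g i : ℝ) * z.2 i) →
      ∀ i, 0 ≤ (s i : ℝ) * z.2 i := fun z hz i => by
    have := hz (Pi.single i (s i))
      (Finset.mem_union_left _ (Finset.mem_image_of_mem _ (Finset.mem_univ i)))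
    simpa [Pi.single_apply] using this
  let lift := fun σ => rationalConeOver (L σ) 𝒢'
  have hmem : ∀ σ ∈ F, ∀ x : (ℝ ⊗[ℤ] N) × ℝ, x ∈ σ ↔ 0 ≤ x.2 ∧ idProd N ι x ∈ lift σ :=
    fun σ hσ x => by
      rw [hφ, mem_rationalConeOver, ← hL σ hσ]
      refine ⟨fun hx => ?_, fun h => h.2.1⟩
      have h0 := hF.supported σ hσ x hx
      refine ⟨h0, hx, fun g hg => ?_⟩
      have := mul_nonneg h0 (h𝒢'pos g hg).le
      rw [Finset.mul_sum] at this
      refine this.trans_eq (Finset.sum_congr rfl fun i _ => ?_)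
      simp only [Pi.smul_apply, smul_eq_mul]
      ring
  have hrat : ∀ τ, ∀ σ ∈ lift '' F, IsConeFace τ σ → IsRationalCone τ := by
    rintro τ _ ⟨σ, hσ, rfl⟩ h
    exact IsConeFace.isRationalCone h
  refine ⟨{τ | ∃ σ ∈ lift '' F, IsConeFace τ σ}, ⟨isFan_faces (hF.isFan.finite.image _)
    (hF.isFan.nonempty.image _) (fun σ hσ => (hrat σ σ hσ (.refl σ)).isPolyhedralCone)
    (fun τ σ hσ h => (hrat τ σ hσ h).isPolyhedralCone) ?_ ?_,
    fun τ ⟨σ, hσ, h⟩ => hrat τ σ hσ h⟩, ?_⟩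
  · rintro _ ⟨σ, hσ, rfl⟩ ⟨w, ξ⟩ hz hz0 hz'
    have hz1 := mem_rationalConeOver.1 hz
    have hz1' := mem_rationalConeOver.1 hz'
    have hξ : ξ = 0 := funext fun i => by
      have h1 := hsz _ hz1.2 i
      have h2 := hsz _ hz1'.2 i
      simp only [Prod.snd_neg, Pi.neg_apply, mul_neg, Left.nonneg_neg_iff] at h1 h2
      have hsi : (s i : ℝ) ≠ 0 := left_ne_zero_of_mul (hse i).ne'
      exact (mul_eq_zero.1 (h2.antisymm h1)).resolve_left hsi
    subst hξ
    have h1 : ((w, 0) : (ℝ ⊗[ℤ] N) × ℝ) ∈ σ := (hmem σ hσ _).2 ⟨le_rfl, by simpa [hφ] using hz⟩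
    have h2 : -((w, 0) : (ℝ ⊗[ℤ] N) × ℝ) ∈ σ :=
      (hmem σ hσ _).2 ⟨by simp, by simpa [hφ] using hz'⟩
    refine hF.isFan.stronglyConvex σ hσ _ h1 (fun h => hz0 ?_) h2
    rw [Prod.mk_eq_zero] at h ⊢
    exact ⟨h.1, rfl⟩
  · rintro _ ⟨σ, hσ, rfl⟩ _ ⟨τ, hτ, rfl⟩
    refine h𝒢face σ τ ⟨hσ, hτ⟩ 𝒢' fun g hg => Finset.mem_union_right _ ?_
    exact Finset.mem_biUnion.2 ⟨(σ, τ), Finset.mem_product.2 ⟨hFf.2 hσ, hFf.2 hτ⟩, hg⟩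
  · ext τ
    constructor
    · intro hτ
      refine ⟨lift τ, ⟨lift τ, ⟨τ, hτ, rfl⟩, .refl _⟩, Or.inl ?_⟩
      ext x
      rw [hmem τ hτ, and_comm, Submodule.mem_inf, mem_upperHalfSpace]
      rfl
    -- The face of a lift cut out by `u` pulls back to the face of `σ` cut out by `u ∘ (id × ι)`;
    -- its part at height zero is a further face, cut out by `t`.
    · rintro ⟨ρ, ⟨_, ⟨σ, hσ, rfl⟩, u, hu, hρ⟩, h⟩
      have hmemρ : ∀ x : (ℝ ⊗[ℤ] N) × ℝ, x ∈ ρ.comap (idProd N ι) ⊓ upperHalfSpace (ℝ ⊗[ℤ] N) ↔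
          x ∈ σ ∧ u.comp (idProd N ι) x = 0 := fun x => by
        rw [Submodule.mem_inf, mem_upperHalfSpace, hmem σ hσ, and_comm, and_assoc]
        exact and_congr_right fun _ => hρ _
      have hρF : ρ.comap (idProd N ι) ⊓ upperHalfSpace (ℝ ⊗[ℤ] N) ∈ F :=
        hF.isFan.face_mem σ hσ _ ⟨u.comp (idProd N ι),
          fun x hx => hu _ ((hmem σ hσ x).1 hx).2, hmemρ⟩
      rcases h with rfl | rfl
      · exact hρF
      · refine hF.isFan.face_mem _ hρF _ ⟨LinearMap.snd ℝ _ _, hF.supported _ hρF, fun x => ?_⟩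
        simp only [Submodule.mem_inf, mem_upperHalfSpace, mem_heightZero, LinearMap.snd_apply]
        exact ⟨fun h => ⟨⟨h.1, h.2.ge⟩, h.2⟩, fun h => ⟨h.1.1, h.2⟩⟩

end Lift

/-! ### Subgroups of finite rank and the reduction to them. -/

theorem finiteDimensional_span_of_fg {Γ : AddSubgroup ℝ} (h : Γ.FG) :
    FiniteDimensional ℚ (Submodule.span ℚ (Γ : Set ℝ)) := by
  obtain ⟨S, rfl⟩ := h
  have hle : Submodule.span ℚ (AddSubgroup.closure (S : Set ℝ) : Set ℝ) ≤
      Submodule.span ℚ (S : Set ℝ) := by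
    rw [Submodule.span_le]
    exact (AddSubgroup.closure_le (Submodule.span ℚ (S : Set ℝ)).toAddSubgroup).2
      Submodule.subset_span
  exact Submodule.finiteDimensional_of_le hle

/-- A subgroup of `ℝ` of finite rank contains linearly independent elements such that every element
of the subgroup has a multiple which is an integral combination of them. -/
theorem exists_integrally_independent {Γ : AddSubgroup ℝ}
    (hfin : FiniteDimensional ℚ (Submodule.span ℚ (Γ : Set ℝ))) :
    ∃ (k : ℕ) (e : Fin k → ℝ), (∀ i, e i ∈ Γ) ∧
      (∀ g : Fin k → ℤ, ∑ i, (g i : ℝ) * e i = 0 → g = 0) ∧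
      ∀ γ ∈ Γ, ∃ n : ℕ, 0 < n ∧ ∃ f : Fin k → ℤ, n * γ = ∑ i, (f i : ℝ) * e i := by
  obtain ⟨b, hbΓ, hspan, hli⟩ := exists_linearIndependent ℚ (Γ : Set ℝ)
  have hspan' : Submodule.span ℚ (Set.range ((↑) : b → ℝ)) = Submodule.span ℚ (Γ : Set ℝ) := by
    rw [Subtype.range_coe, hspan]
  rw [← hspan'] at hfin
  have : Finite b := Module.Finite.finite_basis (Module.Basis.span hli)
  let E := (Finite.equivFin b).symm
  refine ⟨Nat.card b, fun i => (E i : ℝ), fun i => hbΓ (E i).2, fun g hg => ?_, fun γ hγ => ?_⟩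
  · have h := Fintype.linearIndependent_iff.1 (hli.comp E E.injective) (fun i => (g i : ℚ)) (by
      simpa [Rat.smul_def] using hg)
    funext i
    exact_mod_cast h i
  · have hmem : γ ∈ Submodule.span ℚ (Set.range fun i => (E i : ℝ)) := by
      have hrange : (Set.range fun i => (E i : ℝ)) = Set.range ((↑) : b → ℝ) :=
        E.surjective.range_comp _
      rw [hrange, hspan']
      exact Submodule.subset_span hγ
    obtain ⟨q, hq⟩ := (Submodule.mem_span_range_iff_exists_fun ℚ).1 hmem
    have hdvd : ∀ i, (q i).den ∣ ∏ j, (q j).den := fun i =>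
      Finset.dvd_prod_of_mem _ (Finset.mem_univ i)
    choose m hm using hdvd
    refine ⟨∏ j, (q j).den, Finset.prod_pos fun j _ => (q j).pos, fun i => m i * (q i).num, ?_⟩
    rw [← hq, Finset.mul_sum]
    refine Finset.sum_congr rfl fun i _ => ?_
    have hden : ((q i).den : ℝ) * (q i : ℝ) = (q i).num := by
      exact_mod_cast Rat.den_mul_eq_num (q i)
    rw [hm i, Rat.smul_def]
    push_cast
    rw [← hden]
    ring

/-- The origin is a face of every strongly convex polyhedral cone. -/
theorem IsStronglyConvex.isConeFace_bot {V : Type*} [AddCommGroup V] [Module ℝ V]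
    {σ : PointedCone ℝ V} (h : IsStronglyConvex σ) (hσ : IsPolyhedralCone σ) :
    IsConeFace ⊥ σ := by
  obtain ⟨L, hL⟩ := hσ
  refine isConeFace_of_forall_eq_zero (S := L) (fun u hu x hx => (hL x).1 hx u hu) fun x => ?_
  rw [Submodule.mem_bot]
  constructor
  · rintro rfl
    exact ⟨zero_mem _, fun u _ => map_zero u⟩
  · rintro ⟨hx, hx0⟩
    by_contra hne
    exact h x hx hne ((hL _).2 fun u hu => by simp [hx0 u hu])

section

variable {N : Type*} [AddCommGroup N]

/-- The origin belongs to every fan, but with zero coefficients only, an admissible cone contains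
`(0, 1)`. This makes `ι 1 ≠ 0` possible for the subgroup generated by the coefficients of a fan. -/
theorem IsAdmissibleFan.ne_bot {Γ : AddSubgroup ℝ} {F : Set (PointedCone ℝ ((ℝ ⊗[ℤ] N) × ℝ))}
    (hF : IsAdmissibleFan Γ F) : Γ ≠ ⊥ := by
  rintro rfl
  obtain ⟨σ, hσ⟩ := hF.isFan.nonempty
  have hbot := hF.isFan.face_mem σ hσ ⊥
    ((hF.isFan.stronglyConvex σ hσ).isConeFace_bot (hF.isFan.polyhedral σ hσ))
  obtain ⟨-, L, hL⟩ := hF.admissible _ hbot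
  have h1 : ((0, 1) : (ℝ ⊗[ℤ] N) × ℝ) ∈ (⊥ : PointedCone ℝ ((ℝ ⊗[ℤ] N) × ℝ)) :=
    (hL _).2 ⟨zero_le_one, fun y _ => by simp [AddSubgroup.mem_bot.1 y.2.2]⟩
  simp at h1

/-- An admissible fan involves only finitely many elements of `Γ`. -/
theorem IsAdmissibleFan.exists_fg {Γ : AddSubgroup ℝ} {F : Set (PointedCone ℝ ((ℝ ⊗[ℤ] N) × ℝ))}
    (hF : IsAdmissibleFan Γ F) : ∃ Γ' ≤ Γ, Γ'.FG ∧ IsAdmissibleFan Γ' F := by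
  classical
  choose! L hL using fun σ (hσ : σ ∈ F) => (hF.admissible σ hσ).2
  let S : Finset ℝ := hF.isFan.finite.toFinset.biUnion fun σ => (L σ).image fun y => (y.2 : ℝ)
  have hS : ∀ σ ∈ F, ∀ y ∈ L σ, (y.2 : ℝ) ∈ AddSubgroup.closure (S : Set ℝ) := fun σ hσ y hy =>
    AddSubgroup.subset_closure <| Finset.mem_coe.2 <| Finset.mem_biUnion.2
      ⟨σ, hF.isFan.finite.mem_toFinset.2 hσ, Finset.mem_image_of_mem _ hy⟩
  refine ⟨AddSubgroup.closure S, ?_, ⟨S, rfl⟩, hF.isFan, hF.supported, fun σ hσ =>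
    ⟨hF.isFan.stronglyConvex σ hσ,
      (L σ).attach.image fun y => (y.1.1, ⟨y.1.2, hS σ hσ y.1 y.2⟩), fun x => ?_⟩⟩
  · rw [AddSubgroup.closure_le]
    intro γ hγ
    obtain ⟨σ, -, hγ⟩ := Finset.mem_biUnion.1 (Finset.mem_coe.1 hγ)
    obtain ⟨y, -, rfl⟩ := Finset.mem_image.1 hγ
    exact y.2.2
  · rw [hL σ hσ, Finset.forall_mem_image]
    refine and_congr_right fun _ => ⟨fun h y _ => h y.1 y.2, fun h y hy => ?_⟩
    have := @h ⟨y, hy⟩ (Finset.mem_attach _ _)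
    exact this

/-- For `Γ` of finite rank, one map `ι` serves all `Γ`-admissible fans. -/
theorem exists_uniform_isRationalFan [Module.Free ℤ N] [Module.Finite ℤ N] {Γ : AddSubgroup ℝ}
    (hΓ : Γ ≠ ⊥) (hfin : FiniteDimensional ℚ (Submodule.span ℚ (Γ : Set ℝ))) :
    ∃ k : ℕ, 0 < k ∧ ∃ ι : ℝ →ₗ[ℝ] (Fin k → ℝ), ι 1 ≠ 0 ∧ (∀ i, ι 1 i ∈ Γ) ∧
      ∀ F : Set (PointedCone ℝ ((ℝ ⊗[ℤ] N) × ℝ)), IsAdmissibleFan Γ F →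
        ∃ G : Set (PointedCone ℝ ((ℝ ⊗[ℤ] N) × (Fin k → ℝ))),
          IsRationalFan G ∧ F = fanPullback (idProd N ι) G := by
  obtain ⟨k, e, heΓ, he, hspan⟩ := exists_integrally_independent hfin
  have hι : LinearMap.toSpanSingleton ℝ (Fin k → ℝ) e 1 = e := by simp
  have he0 : e ≠ 0 := by
    rintro rfl
    refine hΓ ((AddSubgroup.eq_bot_iff_forall _).2 fun γ hγ => ?_)
    obtain ⟨n, hn, f, hf⟩ := hspan γ hγ
    simpa [hn.ne'] using hf
  have hk : 0 < k := by
    obtain ⟨i, -⟩ := Function.ne_iff.1 he0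
    exact i.pos
  refine ⟨k, hk, LinearMap.toSpanSingleton ℝ _ e, by rwa [hι], by rwa [hι], fun F hF => ?_⟩
  exact hF.exists_isRationalFan hk (by rwa [hι]) (by rwa [hι])

end

theorem theorem1p3 (N : Type*) [AddCommGroup N] [Module.Free ℤ N] [Module.Finite ℤ N]
    (Γ : AddSubgroup ℝ) :
    (∀ F : Set (PointedCone ℝ ((ℝ ⊗[ℤ] N) × ℝ)), IsAdmissibleFan Γ F →
      ∃ k : ℕ, 0 < k ∧ ∃ ι : ℝ →ₗ[ℝ] (Fin k → ℝ), ι 1 ≠ 0 ∧ (∀ i, ι 1 i ∈ Γ) ∧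
        ∃ G : Set (PointedCone ℝ ((ℝ ⊗[ℤ] N) × (Fin k → ℝ))),
          IsRationalFan G ∧ F = fanPullback (idProd N ι) G) ∧
    (Γ ≠ ⊥ → (Γ.FG ∨ FiniteDimensional ℚ (Submodule.span ℚ (Γ : Set ℝ))) →
      ∃ k : ℕ, 0 < k ∧ ∃ ι : ℝ →ₗ[ℝ] (Fin k → ℝ), ι 1 ≠ 0 ∧ (∀ i, ι 1 i ∈ Γ) ∧
        ∀ F : Set (PointedCone ℝ ((ℝ ⊗[ℤ] N) × ℝ)), IsAdmissibleFan Γ F →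
          ∃ G : Set (PointedCone ℝ ((ℝ ⊗[ℤ] N) × (Fin k → ℝ))),
            IsRationalFan G ∧ F = fanPullback (idProd N ι) G) := by
  refine ⟨fun F hF => ?_, fun hΓ hfin => ?_⟩
  · obtain ⟨Γ', hle, hfg, hF'⟩ := hF.exists_fg
    obtain ⟨k, hk, ι, hι, hιΓ, h⟩ :=
      exists_uniform_isRationalFan (N := N) hF'.ne_bot (finiteDimensional_span_of_fg hfg)
    exact ⟨k, hk, ι, hι, fun i => hle (hιΓ i), h F hF'⟩
  · exact exists_uniform_isRationalFan hΓ (hfin.elim finiteDimensional_span_of_fg id)
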